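/- Let $F$ be an algebraically closed field of characteristic $0$, and let $L$ and $\mathfrak g$ be finite dimensional Lie algebras over $F$. Suppose that $\mathfrak g$ is semisimple and acts on $L$ by derivations, that is, a homomorphism of Lie algebras $\rho\colon\mathfrak g\to\operatorname{Der}_F(L)$ is given. Let $R$ be the solvable radical of $L$. Then there exists a Lie subalgebra $B\subseteq L$ that is maximal (with respect to inclusion) among the semisimple Lie subalgebras of $L$, such that $B$ and $R$ are both $\mathfrak g$-submodules of $L$, i.e. $\rho(x)B\subseteq B$ and $\rho(x)R\subseteq R$ for all $x\in\mathfrak g$, and $L=B\oplus R$ as a direct sum of vector spaces (hence of $\mathfrak g$-submodules). Here the zero Lie algebra counts as semisimple. -/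

import Mathlib

/-! Put `S = L ⋊ 𝔤`. The radical of `S` projects to a solvable ideal of the semisimple `𝔤`, hence to
zero, so it lies in the ideal `L` and equals `R`. A relative Levi theorem
(`exists_complement_of_solvable_ker`) gives a complement `C` of `rad S` that contains `𝔤`, and `B =
C ∩ L` works. It is `𝔤`-stable because `𝔤 ⊆ C` and `L` is an ideal; it complements `R` because `rad
S ⊆ L`. A complement of `R` is automatically a maximal semisimple subalgebra.

The relative Levi theorem reduces by induction on dimension to an abelian kernel `V`. There
Whitehead's first lemma, applied twice to maps `S → S`, yields a linear projection onto `V` that is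
invariant under `𝔞` and, up to `ad V`, under `S`. Its stabilizer `T` contains `𝔞`, still maps onto
the quotient, and meets `V` centrally; in the central case the kernel of such a projection is the
required subalgebra. -/

open LieAlgebra

/-! ### Whitehead's first lemma, by means of the Casimir operator. -/

section Whitehead

/-- If `β` is an invariant form and `e`, `f` are families which are dual to each other with
respect to `β` modulo the kernel of a bilinear expression `T`, then `∑ T (e i) (f i)` is
invariant. -/
theorem sum_casimir_invariant {F : Type*} [Field F] {L : Type*} [LieRing L] [LieAlgebra F L]
    {ι : Type*} [Fintype ι] (β : LinearMap.BilinForm F L)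
    (hβ : ∀ x y z, β ⁅x, y⁆ z = β x ⁅y, z⁆) (e f : ι → L)
    {M : Type*} [AddCommGroup M] [Module F M] (T : L →ₗ[F] L →ₗ[F] M)
    (he : ∀ x y, T x y = ∑ i, β x (f i) • T (e i) y)
    (hf : ∀ x y, T x y = ∑ i, β (e i) y • T x (f i)) (x : L) :
    ∑ i, (T ⁅x, e i⁆ (f i) + T (e i) ⁅x, f i⁆) = 0 := by
  rw [Finset.sum_add_distrib]
  have h1 : ∑ i, T ⁅x, e i⁆ (f i) = ∑ i, ∑ j, β ⁅x, e i⁆ (f j) • T (e j) (f i) :=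
    Finset.sum_congr rfl fun i _ => he _ _
  have h2 : ∑ i, T (e i) ⁅x, f i⁆ = ∑ i, ∑ j, β (e j) ⁅x, f i⁆ • T (e i) (f j) :=
    Finset.sum_congr rfl fun i _ => hf _ _
  rw [h1, h2, Finset.sum_comm, ← Finset.sum_add_distrib]
  refine Finset.sum_eq_zero fun i _ => ?_
  rw [← Finset.sum_add_distrib]
  refine Finset.sum_eq_zero fun j _ => ?_
  rw [← add_smul, ← hβ, ← lie_skew (e j) x, map_neg, LinearMap.neg_apply, add_neg_cancel,
    zero_smul]

variable {F : Type*} [Field F] [CharZero F]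
  {L : Type*} [LieRing L] [LieAlgebra F L] [FiniteDimensional F L]

/-- The part of `K` in the complement of `⁅K, K⁆` has its bracket in both, so it is an abelian ideal
and vanishes. -/
theorem LieAlgebra.HasTrivialRadical.lie_self_eq [HasTrivialRadical F L] (K : LieIdeal F L) :
    ⁅K, K⁆ = K := by
  refine le_antisymm (LieSubmodule.lie_le_left K K) ?_
  set I : LieIdeal F L := ⁅K, K⁆
  have hd : Disjoint I Iᶜ := disjoint_compl_right
  have hJ : K ⊓ Iᶜ = ⊥ := by
    refine (hasTrivialRadical_iff_no_abelian_ideals F L).mp inferInstance _ ?_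
    rw [LieSubmodule.lie_abelian_iff_lie_self_eq_bot, eq_bot_iff]
    refine le_trans (le_inf ?_ ?_) hd.le_bot
    · exact LieSubmodule.mono_lie inf_le_left inf_le_left
    · exact (LieSubmodule.lie_le_left _ _).trans inf_le_right
  exact disjoint_compl_right_iff.mp (disjoint_iff.mpr hJ)

variable {N : Type*} [AddCommGroup N] [Module F N] [LieRingModule L N]

/-- `K` is perfect, and the cocycle rule kills brackets of elements that act trivially. -/
theorem cocycle_eq_zero_of_mem [HasTrivialRadical F L] (K : LieIdeal F L)
    (hK : ∀ x ∈ K, ∀ n : N, ⁅x, n⁆ = 0) (c : L →ₗ[F] N)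
    (hc : ∀ x y, c ⁅x, y⁆ = ⁅x, c y⁆ - ⁅y, c x⁆) {x : L} (hx : x ∈ K) : c x = 0 := by
  rw [← HasTrivialRadical.lie_self_eq K, ← LieSubmodule.mem_toSubmodule,
    LieSubmodule.lieIdeal_oper_eq_linear_span'] at hx
  induction hx using Submodule.span_induction with
  | mem x h =>
    obtain ⟨a, ha, b, hb, rfl⟩ := h
    rw [hc, hK a ha, hK b hb, sub_zero]
  | zero => simp
  | add x y _ _ hx hy => simp [hx, hy]
  | smul t x _ hx => simp [hx]

variable [LieModule F L N]

-- Cartan's criterion: on the kernel `K` of the trace form, the derived ideal acts nilpotently, and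
-- `K` is perfect. By irreducibility `⁅K, N⁆` is `0` or `N`, and nilpotency excludes `N`.
open LieModule in
theorem ker_traceForm_le_of_isIrreducible [FiniteDimensional F N] [HasTrivialRadical F L]
    [IsIrreducible F L N] {x : L} (hx : traceForm F L N x = 0) (n : N) : ⁅x, n⁆ = 0 := by
  let K : LieIdeal F L :=
    { LinearMap.ker (traceForm F L N) with
      lie_mem := by
        intro y m hm
        change traceForm F L N m = 0 at hm
        change traceForm F L N ⁅y, m⁆ = 0
        ext z
        rw [← lie_skew, map_neg, LinearMap.neg_apply, traceForm_apply_lie_apply, hm]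
        simp }
  have hxK : x ∈ K := hx
  have h0 : traceForm F K N = 0 := by
    ext ⟨a, ha⟩ ⟨b, hb⟩
    change traceForm F L N a b = 0
    rw [show traceForm F L N a = 0 from ha]; rfl
  have hnil := isNilpotent_derivedSeries_of_traceForm_eq_zero h0
  rw [isNilpotent_iff_forall' (R := F)] at hnil
  have hnil' : LieModule.IsNilpotent K N := by
    rw [isNilpotent_iff_forall' (R := F)]
    rintro ⟨a, ha⟩
    refine hnil ⟨⟨a, ha⟩, ?_⟩
    rw [LieIdeal.derivedSeries_eq_derivedSeriesOfIdeal_comap, LieIdeal.mem_comap]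
    change a ∈ ⁅K, K⁆
    rwa [HasTrivialRadical.lie_self_eq]
  rcases eq_bot_or_eq_top ⁅K, (⊤ : LieSubmodule F L N)⁆ with h | h
  · rw [LieSubmodule.lie_eq_bot_iff] at h
    exact h x hxK n trivial
  · exfalso
    obtain ⟨k, hk⟩ := (isNilpotent_iff F K N).mp hnil'
    have hall : ∀ k, K.lcs N k = ⊤ := by
      intro k
      induction k with
      | zero => rfl
      | succ k ih => rw [LieIdeal.lcs_succ, ih, h]
    have := LieIdeal.coe_lcs_eq K N (k := k)
    rw [hk, hall] at this
    have hN := nontrivial_of_isIrreducible F L N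
    simp at this

/-- A family and a dual family, with respect to the trace form of an irreducible module,
modulo the kernel of the representation. -/
theorem exists_dual_families [FiniteDimensional F N] [HasTrivialRadical F L]
    [LieModule.IsIrreducible F L N] :
    ∃ (n : ℕ) (e f : Fin n → L),
      (∀ i, LieModule.traceForm F L N (e i) (f i) = 1) ∧
      (∀ x, ∀ m : N, ⁅x - ∑ i, LieModule.traceForm F L N x (f i) • e i, m⁆ = 0) ∧
      (∀ x, ∀ m : N, ⁅x - ∑ i, LieModule.traceForm F L N (e i) x • f i, m⁆ = 0) := by
  classical
  set β := LieModule.traceForm F L N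
  obtain ⟨H, hH⟩ := (LinearMap.ker β).exists_isCompl
  have hsymm : ∀ x y, β x y = β y x := LieModule.traceForm_comm F L N
  let βH : LinearMap.BilinForm F H := β.restrict H
  have hnd : βH.Nondegenerate := by
    have hrefl : βH.IsRefl := fun a b h => by
      rw [← h]; exact hsymm _ _
    refine (LinearMap.IsRefl.nondegenerate_iff_separatingLeft hrefl).mpr fun a ha => ?_
    have : (a : L) ∈ LinearMap.ker β := by
      rw [LinearMap.mem_ker]
      ext y
      obtain ⟨k, hk, h, hh, rfl⟩ := Submodule.mem_sup.mp
        (hH.sup_eq_top ▸ Submodule.mem_top : y ∈ LinearMap.ker β ⊔ H)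
      rw [map_add, hsymm a k, LinearMap.mem_ker.mp hk]
      simpa using (show β a h = 0 from ha ⟨h, hh⟩)
    exact Subtype.ext (Submodule.disjoint_def.mp hH.disjoint a this a.2)
  let b := Module.finBasis F H
  let d := βH.dualBasis hnd b
  have hbd : ∀ i j, β (d i) (b j) = if j = i then 1 else 0 := fun i j =>
    LinearMap.BilinForm.apply_dualBasis_left hnd b i j
  have key : ∀ (e f : Fin (Module.finrank F H) → L),
      (∀ h ∈ H, h = ∑ i, β h (f i) • e i) → (∀ i, f i ∈ H) →
      ∀ x, ∀ m : N, ⁅x - ∑ i, β x (f i) • e i, m⁆ = 0 := by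
    intro e f hef hf x m
    obtain ⟨k, hk, h, hh, rfl⟩ := Submodule.mem_sup.mp
        (hH.sup_eq_top ▸ Submodule.mem_top : x ∈ LinearMap.ker β ⊔ H)
    have : ∀ i, β (k + h) (f i) = β h (f i) := fun i => by
      rw [map_add, LinearMap.mem_ker.mp hk, zero_add]
    simp_rw [this]
    rw [← hef h hh, add_sub_cancel_right]
    exact ker_traceForm_le_of_isIrreducible (LinearMap.mem_ker.mp hk) m
  refine ⟨_, fun i => d i, fun i => b i, fun i => by simp [hbd], ?_, ?_⟩
  · refine key _ _ (fun h hh => ?_) fun i => (b i).2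
    have := congrArg Subtype.val (d.sum_repr ⟨h, hh⟩)
    simp only [d, LinearMap.BilinForm.dualBasis_repr_apply, Submodule.coe_sum,
      Submodule.coe_smul] at this
    exact this.symm
  · simp_rw [hsymm (d _)]
    refine key _ _ (fun h hh => ?_) fun i => (d i).2
    have hs : βH.IsSymm := ⟨fun a b => hsymm _ _⟩
    have := congrArg Subtype.val (b.sum_repr ⟨h, hh⟩)
    have hr : ∀ x i, b.repr x i = βH x (d i) := fun x i => by
      conv_lhs => rw [← LinearMap.BilinForm.dualBasis_dualBasis hnd hs b]
      exact LinearMap.BilinForm.dualBasis_repr_apply hnd d x i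
    simp only [hr, Submodule.coe_sum, Submodule.coe_smul] at this
    exact this.symm

/-- **Whitehead's first lemma** for irreducible modules. -/
theorem exists_eq_lie_of_cocycle_of_isIrreducible [FiniteDimensional F N] [HasTrivialRadical F L]
    [LieModule.IsIrreducible F L N] (c : L →ₗ[F] N)
    (hc : ∀ x y, c ⁅x, y⁆ = ⁅x, c y⁆ - ⁅y, c x⁆) : ∃ n : N, ∀ x, c x = ⁅x, n⁆ := by
  classical
  let K : LieIdeal F L := LieModule.ker F L N
  have hK : ∀ x, x ∈ K ↔ ∀ n : N, ⁅x, n⁆ = 0 := fun x => LieModule.mem_ker F L N x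
  by_cases htop : K = ⊤
  · refine ⟨0, fun x => ?_⟩
    rw [lie_zero]
    exact cocycle_eq_zero_of_mem K (fun x hx => (hK x).mp hx) c hc (htop ▸ LieSubmodule.mem_top x)
  obtain ⟨n, e, f, hef, he, hf⟩ := exists_dual_families (F := F) (L := L) (N := N)
  set β := LieModule.traceForm F L N
  have hn : (n : F) ≠ 0 := by
    rw [Nat.cast_ne_zero]
    rintro rfl
    refine htop (eq_top_iff.mpr fun x _ => (hK x).mpr fun m => ?_)
    simpa using he x m
  have hβ : ∀ x y z, β ⁅x, y⁆ z = β x ⁅y, z⁆ := LieModule.traceForm_apply_lie_apply F L N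
  have hc0 : ∀ x, (∀ m : N, ⁅x, m⁆ = 0) → c x = 0 := fun x hx =>
    cocycle_eq_zero_of_mem K (fun x hx => (hK x).mp hx) c hc ((hK x).mpr hx)
  have he' : ∀ x, ∀ m : N, ⁅x, m⁆ = ∑ i, β x (f i) • ⁅e i, m⁆ := fun x m => by
    have := he x m
    simpa only [sub_lie, sub_eq_zero, sum_lie, smul_lie] using this
  have hf' : ∀ x, ∀ m : N, ⁅x, m⁆ = ∑ i, β (e i) x • ⁅f i, m⁆ := fun x m => by
    have := hf x m
    simpa only [sub_lie, sub_eq_zero, sum_lie, smul_lie] using this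
  have hcf : ∀ x, c x = ∑ i, β (e i) x • c (f i) := fun x => by
    have := hc0 _ (hf x)
    simpa only [map_sub, sub_eq_zero, map_sum, map_smul] using this
  let φ : L →ₗ[F] Module.End F N := LinearMap.mk₂ F (fun x m => ⁅x, m⁆)
    add_lie smul_lie lie_add (fun a x m => lie_smul a x m)
  have hφ : ∀ x m, φ x m = ⁅x, m⁆ := fun x m => rfl
  let Ω : Module.End F N := ∑ i, φ (e i) * φ (f i)
  have hΩ : ∀ m, Ω m = ∑ i, ⁅e i, ⁅f i, m⁆⁆ := fun m => by simp [Ω, hφ]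
  have hcomm : ∀ x m, Ω ⁅x, m⁆ = ⁅x, Ω m⁆ := fun x m => by
    have h := sum_casimir_invariant β hβ e f
      -- Here `T x y = φ x * φ y`, so invariance says that the Casimir operator commutes with `L`.
      ((LinearMap.mul F (Module.End F N)).compl₁₂ φ φ)
      (fun x y => by
        ext m
        simpa [hφ] using he' x ⁅y, m⁆)
      (fun x y => by
        ext m
        simpa [hφ, lie_sum] using congrArg (⁅x, ·⁆) (hf' y m)) x
    replace h := LinearMap.congr_fun h m
    simp only [LinearMap.compl₁₂_apply, LinearMap.mul_apply', LinearMap.sum_apply,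
      LinearMap.add_apply, Module.End.mul_apply, hφ, LinearMap.zero_apply, lie_lie, lie_sub] at h
    rw [hΩ, hΩ, lie_sum, eq_comm, ← sub_eq_zero, ← Finset.sum_sub_distrib, ← h]
    exact Finset.sum_congr rfl fun i _ => by abel
  have htr : LinearMap.trace F N Ω = n := by
    simp only [Ω, map_sum]
    rw [Finset.sum_congr rfl fun i _ => show LinearMap.trace F N (φ (e i) * φ (f i)) = 1 from hef i]
    simp
  have hker : LinearMap.ker Ω = ⊥ := by
    let P : LieSubmodule F L N :=
      { LinearMap.ker Ω with
        lie_mem := by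
          intro x m hm
          change Ω m = 0 at hm
          change Ω ⁅x, m⁆ = 0
          rw [hcomm, hm, lie_zero] }
    rcases eq_bot_or_eq_top P with h | h
    · exact congrArg LieSubmodule.toSubmodule h
    · have : Ω = 0 := LinearMap.ker_eq_top.mp (congrArg LieSubmodule.toSubmodule h)
      rw [this, map_zero] at htr
      exact absurd htr.symm hn
  have hsurj : Function.Surjective Ω :=
    LinearMap.injective_iff_surjective.mp (LinearMap.ker_eq_bot.mp hker)
  -- The choice is forced: `c x = ⁅x, m⁆` would give `Ω m = ∑ ⁅e i, ⁅f i, m⁆⁆ = ∑ ⁅e i, c (f i)⁆`.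
  obtain ⟨m, hm⟩ := hsurj (∑ i, ⁅e i, c (f i)⁆)
  refine ⟨m, fun x => LinearMap.ker_eq_bot.mp hker ?_⟩
  rw [hcomm, hm, hΩ, lie_sum]
  have h := sum_casimir_invariant β hβ e f (φ.compl₂ c)
    (fun x y => by simpa [hφ] using he' x (c y))
    (fun x y => by simpa [hφ, lie_sum] using congrArg (⁅x, ·⁆) (hcf y)) x
  simp only [LinearMap.compl₂_apply, hφ, hc, lie_lie, lie_sub] at h
  rw [eq_comm, ← sub_eq_zero, ← Finset.sum_sub_distrib, ← h]
  exact Finset.sum_congr rfl fun i _ => by abel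

/-- **Whitehead's first lemma**: a derivation of a semisimple Lie algebra in characteristic zero
with values in a finite-dimensional module is inner. -/
theorem exists_eq_lie_of_cocycle [HasTrivialRadical F L] [FiniteDimensional F N]
    (c : L →ₗ[F] N) (hc : ∀ x y, c ⁅x, y⁆ = ⁅x, c y⁆ - ⁅y, c x⁆) :
    ∃ n : N, ∀ x, c x = ⁅x, n⁆ := by
  induction h : Module.finrank F N using Nat.strong_induction_on generalizing N with
  | _ d ih =>
  subst h
  by_cases hirr : LieModule.IsIrreducible F L N
  · exact exists_eq_lie_of_cocycle_of_isIrreducible c hc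
  rcases subsingleton_or_nontrivial N with hN | hN
  · exact ⟨0, fun x => Subsingleton.elim _ _⟩
  obtain ⟨P, hP, hP'⟩ : ∃ P : LieSubmodule F L N, P ≠ ⊥ ∧ P ≠ ⊤ := by
    by_contra! hcon
    exact hirr (LieModule.IsIrreducible.mk hcon)
  have hPs : P.toSubmodule ≠ ⊤ := by simpa using hP'
  have hPb : P.toSubmodule ≠ ⊥ := by simpa using hP
  have hsum := Submodule.finrank_quotient_add_finrank P.toSubmodule
  have hlt : Module.finrank F P < Module.finrank F N := Submodule.finrank_lt hPs
  have hpos : 0 < Module.finrank F P :=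
    Module.finrank_pos_iff.mpr (Submodule.nontrivial_iff_ne_bot.mpr hPb)
  have : FiniteDimensional F (N ⧸ P) := inferInstanceAs (FiniteDimensional F (N ⧸ P.toSubmodule))
  have : FiniteDimensional F P := inferInstanceAs (FiniteDimensional F P.toSubmodule)
  have hq : Module.finrank F (N ⧸ P) < Module.finrank F N := by
    change Module.finrank F (N ⧸ P.toSubmodule) < _
    change 0 < Module.finrank F P.toSubmodule at hpos
    omega
  obtain ⟨nbar, hn⟩ := ih _ hq ((LieSubmodule.Quotient.mk' P : N →ₗ[F] N ⧸ P) ∘ₗ c)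
    (fun x y => by
      simp only [LinearMap.comp_apply, hc, map_sub]
      exact congrArg₂ _ (LieModuleHom.map_lie _ _ _) (LieModuleHom.map_lie _ _ _)) rfl
  obtain ⟨n, rfl⟩ := LieSubmodule.Quotient.surjective_mk' P nbar
  have hmem : ∀ x, c x - ⁅x, n⁆ ∈ P := fun x => by
    rw [← LieSubmodule.Quotient.mk_eq_zero, map_sub, LieModuleHom.map_lie, sub_eq_zero]
    exact hn x
  -- A solution modulo `P`, lifted to `n`, leaves a cocycle with values in `P`.
  let c' : L →ₗ[F] P := LinearMap.codRestrict P.toSubmodule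
    (c - LieDerivation.inner F L N n) hmem
  obtain ⟨p, hp⟩ := ih _ hlt c' (fun x y => by
    apply Subtype.ext
    change c ⁅x, y⁆ - ⁅⁅x, y⁆, n⁆ = ⁅x, c y - ⁅y, n⁆⁆ - ⁅y, c x - ⁅x, n⁆⁆
    rw [hc, lie_lie, lie_sub, lie_sub]
    abel) rfl
  refine ⟨n + p, fun x => ?_⟩
  have := congrArg Subtype.val (hp x)
  change c x - ⁅x, n⁆ = ⁅x, (p : N)⁆ at this
  rw [lie_add, ← this]
  abel

end Whitehead

/-! ### Splitting surjections with abelian kernel. -/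

section AbelianKernel

variable {F : Type*} [Field F] [CharZero F]
  {S : Type*} [LieRing S] [LieAlgebra F S]
  {Q : Type*} [LieRing Q] [LieAlgebra F Q] [FiniteDimensional F Q] [HasTrivialRadical F Q]
  {𝔞 : Type*} [LieRing 𝔞] [LieAlgebra F 𝔞] [FiniteDimensional F 𝔞] [HasTrivialRadical F 𝔞]

theorem exists_eq_lie_of_cocycle_comp {N : Type*} [AddCommGroup N] [Module F N]
    [FiniteDimensional F N] [LieRingModule S N] [LieModule F S N] (α : 𝔞 →ₗ⁅F⁆ S)
    (c : 𝔞 →ₗ[F] N) (hc : ∀ a b, c ⁅a, b⁆ = ⁅α a, c b⁆ - ⁅α b, c a⁆) :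
    ∃ n : N, ∀ a, c a = ⁅α a, n⁆ := by
  let _inst := LieRingModule.compLieHom N α
  have := LieModule.compLieHom (R := F) N α
  exact exists_eq_lie_of_cocycle c hc

/-- Both the action and the cocycle descend to `Q`, so a merely linear section of `f` suffices to
transport them. -/
theorem exists_eq_lie_of_cocycle_of_surjective {N : Type*} [AddCommGroup N] [Module F N]
    [FiniteDimensional F N] [LieRingModule S N] [LieModule F S N] (f : S →ₗ⁅F⁆ Q)
    (hf : Function.Surjective f) (hN : ∀ x, f x = 0 → ∀ n : N, ⁅x, n⁆ = 0)
    (c : S →ₗ[F] N) (hc : ∀ x y, c ⁅x, y⁆ = ⁅x, c y⁆ - ⁅y, c x⁆) (hc0 : ∀ x, f x = 0 → c x = 0) :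
    ∃ n : N, ∀ x, c x = ⁅x, n⁆ := by
  obtain ⟨s, hs⟩ := (f : S →ₗ[F] Q).exists_rightInverse_of_surjective (LinearMap.range_eq_top.mpr hf)
  replace hs : ∀ q, f (s q) = q := LinearMap.congr_fun hs
  have hact : ∀ x y, f x = f y → ∀ n : N, ⁅x, n⁆ = ⁅y, n⁆ := fun x y h n => by
    rw [← sub_eq_zero, ← sub_lie]
    exact hN _ (by rw [map_sub, h, sub_self]) n
  have hcc : ∀ x y, f x = f y → c x = c y := fun x y h => by
    rw [← sub_eq_zero, ← map_sub]
    exact hc0 _ (by rw [map_sub, h, sub_self])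
  let i₁ : LieRingModule Q N :=
    { bracket := fun q n => ⁅s q, n⁆
      add_lie := fun x y n => by rw [map_add, add_lie]
      lie_add := fun x n m => lie_add _ _ _
      leibniz_lie := fun x y n => by
        change ⁅s x, ⁅s y, n⁆⁆ = ⁅s ⁅x, y⁆, n⁆ + ⁅s y, ⁅s x, n⁆⁆
        rw [hact (s ⁅x, y⁆) ⁅s x, s y⁆ (by rw [LieHom.map_lie, hs, hs, hs]), leibniz_lie] }
  have i₂ : LieModule F Q N :=
    { smul_lie := fun t x n => by change ⁅s (t • x), n⁆ = t • ⁅s x, n⁆; rw [map_smul, smul_lie]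
      lie_smul := fun t x n => lie_smul t (s x) n }
  obtain ⟨n, hn⟩ := exists_eq_lie_of_cocycle (L := Q) (N := N) (c ∘ₗ s) (fun x y => by
    change c (s ⁅x, y⁆) = ⁅s x, c (s y)⁆ - ⁅s y, c (s x)⁆
    rw [← hc]
    exact hcc _ _ (by rw [LieHom.map_lie, hs, hs, hs]))
  refine ⟨n, fun x => ?_⟩
  rw [hcc x (s (f x)) (hs _).symm, hact x (s (f x)) (hs _).symm]
  exact hn (f x)

variable [FiniteDimensional F S]

/-- If `f` is surjective onto a semisimple Lie algebra and has abelian kernel `V`, then there is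
a projection `φ` onto `V` which is invariant up to inner derivations by elements of `V`, and
invariant under a given semisimple Lie algebra. -/
theorem exists_projection_of_abelian_ker (f : S →ₗ⁅F⁆ Q) (hf : Function.Surjective f)
    (hV : ∀ v w : S, f v = 0 → f w = 0 → ⁅v, w⁆ = 0) (α : 𝔞 →ₗ⁅F⁆ S) :
    ∃ φ : S →ₗ[F] S, (∀ x, f (φ x) = 0) ∧ (∀ v, f v = 0 → φ v = v) ∧
      (∀ x : S, ∃ v : S, f v = 0 ∧ ∀ y : S, ⁅x, φ y⁆ - φ ⁅x, y⁆ = ⁅v, y⁆) ∧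
      ∀ a (y : S), ⁅α a, φ y⁆ = φ ⁅α a, y⁆ := by
  have hfl : ∀ x v : S, f v = 0 → f ⁅x, v⁆ = 0 := fun x v hv => by rw [LieHom.map_lie, hv, lie_zero]
  have hfr : ∀ x v : S, f v = 0 → f ⁅v, x⁆ = 0 := fun x v hv => by rw [LieHom.map_lie, hv, zero_lie]
  obtain ⟨g, hg⟩ := (LinearMap.ker (f : S →ₗ[F] Q)).subtype.exists_leftInverse_of_injective
    (Submodule.ker_subtype _)
  let φ₀ : S →ₗ[F] S := (LinearMap.ker (f : S →ₗ[F] Q)).subtype ∘ₗ g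
  have hφ₀ : ∀ x, f (φ₀ x) = 0 := fun x => (g x).2
  have hφ₀' : ∀ v, f v = 0 → φ₀ v = v := fun v hv =>
    congrArg Subtype.val (LinearMap.congr_fun hg ⟨v, hv⟩)
  -- With `V = ker f`, `W` consists of the differences of linear projections onto `V`; `P` below is
  -- `ad V`, contained in `W` since `V` is abelian.
  let W : LieSubmodule F S (S →ₗ[F] S) :=
    { carrier := {φ | (∀ y, f (φ y) = 0) ∧ ∀ v, f v = 0 → φ v = 0}
      add_mem' := fun {a b} ha hb => ⟨fun y => by simp [ha.1, hb.1], fun v hv => by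
        simp [ha.2 v hv, hb.2 v hv]⟩
      zero_mem' := ⟨fun y => by simp, fun v _ => by simp⟩
      smul_mem' := fun t a ha => ⟨fun y => by simp [ha.1], fun v hv => by simp [ha.2 v hv]⟩
      lie_mem := fun {x a} ha => ⟨fun y => by
        rw [LieHom.lie_apply, map_sub, hfl _ _ (ha.1 y), ha.1, sub_zero], fun v hv => by
        rw [LieHom.lie_apply, ha.2 v hv, ha.2 _ (hfl x v hv), lie_zero, sub_zero]⟩ }
  let P : LieSubmodule F S (S →ₗ[F] S) :=
    { carrier := {φ | ∃ v : S, f v = 0 ∧ ∀ y : S, φ y = ⁅v, y⁆}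
      add_mem' := by
        rintro a b ⟨v, hv, ha⟩ ⟨w, hw, hb⟩
        exact ⟨v + w, by rw [map_add, hv, hw, add_zero], fun y => by simp [ha, hb]⟩
      zero_mem' := ⟨0, map_zero f, fun y => by simp⟩
      smul_mem' := by
        rintro t a ⟨v, hv, ha⟩
        exact ⟨t • v, by rw [map_smul, hv, smul_zero], fun y => by simp [ha]⟩
      lie_mem := by
        rintro x a ⟨v, hv, ha⟩
        exact ⟨⁅x, v⁆, hfl x v hv, fun y => by rw [LieHom.lie_apply, ha, ha, lie_lie]⟩ }
  let P' : LieSubmodule F S W := P.comap W.incl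
  have : FiniteDimensional F (W ⧸ P') := inferInstanceAs (FiniteDimensional F (W ⧸ P'.toSubmodule))
  -- `φ₀` is not in `W`, so this cocycle `x ↦ ⁅x, φ₀⁆` need not be a coboundary. Modulo `ad V` it
  -- factors through `Q`, since `⁅x, φ₀⁆ = -ad x` for `x ∈ V`.
  let c : S →ₗ[F] W := LinearMap.codRestrict W.toSubmodule
    (LieDerivation.inner F S (S →ₗ[F] S) φ₀ : S →ₗ[F] S →ₗ[F] S) (fun x => by
      change ⁅x, φ₀⁆ ∈ W
      refine ⟨fun y => ?_, fun v hv => ?_⟩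
      · rw [LieHom.lie_apply, map_sub, hfl _ _ (hφ₀ y), hφ₀, sub_zero]
      · rw [LieHom.lie_apply, hφ₀' v hv, hφ₀' _ (hfl x v hv), sub_self])
  have hc : ∀ x y, c ⁅x, y⁆ = ⁅x, c y⁆ - ⁅y, c x⁆ := fun x y => Subtype.ext (lie_lie x y φ₀)
  obtain ⟨ψ', hψ⟩ := exists_eq_lie_of_cocycle_of_surjective f hf (N := W ⧸ P')
    (fun x hx n => by
      obtain ⟨n, rfl⟩ := LieSubmodule.Quotient.surjective_mk' P' n
      rw [← LieModuleHom.map_lie]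
      have : ⁅x, n⁆ = 0 := by
        refine Subtype.ext (LinearMap.ext fun y => ?_)
        change ⁅x, (n : S →ₗ[F] S)⁆ y = 0
        rw [LieHom.lie_apply, hV x _ hx (n.2.1 y), n.2.2 _ (hfr y x hx), sub_zero]
      rw [this, map_zero])
    ((LieSubmodule.Quotient.mk' P' : W →ₗ[F] W ⧸ P') ∘ₗ c)
    (fun x y => by
      simp only [LinearMap.comp_apply, hc, map_sub]
      exact congrArg₂ _ (LieModuleHom.map_lie _ _ _) (LieModuleHom.map_lie _ _ _))
    (fun x hx => by
      refine (LieSubmodule.Quotient.mk_eq_zero P').mpr ?_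
      refine ⟨-x, by rw [map_neg, hx, neg_zero], fun y => ?_⟩
      change ⁅x, φ₀⁆ y = _
      rw [LieHom.lie_apply, hV x _ hx (hφ₀ y), hφ₀' _ (hfr y x hx), zero_sub, neg_lie])
  obtain ⟨ψ, rfl⟩ := LieSubmodule.Quotient.surjective_mk' P' ψ'
  let φ₁ : S →ₗ[F] S := φ₀ - ψ
  have hφ₁ : ∀ x, ⁅x, φ₁⁆ ∈ P := fun x => by
    have h : c x - ⁅x, ψ⁆ ∈ P' := by
      rw [← LieSubmodule.Quotient.mk_eq_zero, map_sub, LieModuleHom.map_lie, sub_eq_zero]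
      exact hψ x
    change ⁅x, φ₀ - (ψ : S →ₗ[F] S)⁆ ∈ P
    rw [lie_sub]
    exact h
  -- The remaining defect lies in `ad V`; over `𝔞` it is a coboundary there, and correcting by an
  -- element of `ad V` keeps the earlier properties.
  let d : 𝔞 →ₗ[F] P := LinearMap.codRestrict P.toSubmodule
    ((LieDerivation.inner F S (S →ₗ[F] S) φ₁ : S →ₗ[F] S →ₗ[F] S) ∘ₗ (α : 𝔞 →ₗ[F] S))
    (fun a => hφ₁ (α a))
  obtain ⟨p, hp⟩ := exists_eq_lie_of_cocycle_comp α d (fun a b => Subtype.ext (by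
    change ⁅α ⁅a, b⁆, φ₁⁆ = ⁅α a, ⁅α b, φ₁⁆⁆ - ⁅α b, ⁅α a, φ₁⁆⁆
    rw [LieHom.map_lie, lie_lie]))
  obtain ⟨v, hv, hpv⟩ := p.2
  refine ⟨φ₁ - p, fun x => ?_, fun w hw => ?_, fun x => ?_, fun a y => ?_⟩
  · simp [φ₁, hφ₀, ψ.2.1 x, hpv, hfr x v hv]
  · simp [φ₁, hφ₀' w hw, ψ.2.2 w hw, hpv, hV v w hv hw]
  · obtain ⟨w, hw, h⟩ := P.sub_mem (hφ₁ x) (LieSubmodule.lie_mem P (x := x) p.2)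
    refine ⟨w, hw, fun y => ?_⟩
    rw [← h, ← lie_sub, LieHom.lie_apply]
  · have h : ⁅α a, φ₁ - (p : S →ₗ[F] S)⁆ = 0 := by
      rw [lie_sub, sub_eq_zero]
      exact congrArg Subtype.val (hp a)
    rw [← sub_eq_zero, ← LieHom.lie_apply, h, LinearMap.zero_apply]

/-- The splitting of a surjection onto a semisimple Lie algebra with central kernel. -/
theorem exists_complement_of_central_ker (f : S →ₗ⁅F⁆ Q) (hf : Function.Surjective f)
    (hV : ∀ v w : S, f v = 0 → ⁅v, w⁆ = 0) (α : 𝔞 →ₗ⁅F⁆ S) :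
    ∃ B : LieSubalgebra F S, (∀ a, α a ∈ B) ∧ (∀ x ∈ B, f x = 0 → x = 0) ∧
      ∀ q, ∃ x ∈ B, f x = q := by
  obtain ⟨φ, h1, h2, h3, h4⟩ := exists_projection_of_abelian_ker f hf (fun v w h _ => hV v w h) α
  have hφ : ∀ x y : S, φ ⁅x, y⁆ = 0 := fun x y => by
    obtain ⟨v, hv, h⟩ := h3 x
    have := h y
    rw [hV v y hv, ← lie_skew, hV _ x (h1 y), neg_zero, zero_sub, neg_eq_zero] at this
    exact this
  refine ⟨{ LinearMap.ker φ with lie_mem' := fun {x y} _ _ => hφ x y }, fun a => ?_,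
    fun x hx hfx => (h2 x hfx).symm.trans hx, fun q => ?_⟩
  · change φ (α a) = 0
    -- `φ` kills all brackets, and `𝔞` is perfect.
    have ha : a ∈ ⁅(⊤ : LieIdeal F 𝔞), (⊤ : LieIdeal F 𝔞)⁆ := by
      rw [HasTrivialRadical.lie_self_eq]; trivial
    rw [← LieSubmodule.mem_toSubmodule, LieSubmodule.lieIdeal_oper_eq_linear_span'] at ha
    induction ha using Submodule.span_induction with
    | mem x h =>
      obtain ⟨a, -, b, -, rfl⟩ := h
      rw [LieHom.map_lie, hφ]
    | zero => simp
    | add x y _ _ hx hy => simp [hx, hy]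
    | smul t x _ hx => simp [hx]
  · obtain ⟨x, rfl⟩ := hf q
    refine ⟨x - φ x, ?_, by rw [map_sub, h1, sub_zero]⟩
    change φ (x - φ x) = 0
    rw [map_sub, h2 _ (h1 x), sub_self]

/-- The splitting of a surjection onto a semisimple Lie algebra with abelian kernel. -/
theorem exists_complement_of_abelian_ker (f : S →ₗ⁅F⁆ Q) (hf : Function.Surjective f)
    (hV : ∀ v w : S, f v = 0 → f w = 0 → ⁅v, w⁆ = 0) (α : 𝔞 →ₗ⁅F⁆ S) :
    ∃ B : LieSubalgebra F S, (∀ a, α a ∈ B) ∧ (∀ x ∈ B, f x = 0 → x = 0) ∧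
      ∀ q, ∃ x ∈ B, f x = q := by
  obtain ⟨φ, h1, h2, h3, h4⟩ := exists_projection_of_abelian_ker f hf hV α
  let T : LieSubalgebra F S :=
    { carrier := {x | ∀ y : S, ⁅x, φ y⁆ = φ ⁅x, y⁆}
      add_mem' := fun {x y} hx hy z => by rw [add_lie, add_lie, map_add, hx z, hy z]
      zero_mem' := fun z => by simp
      smul_mem' := fun t x hx z => by rw [smul_lie, smul_lie, map_smul, hx z]
      lie_mem' := fun {x y} hx hy z => by
        rw [lie_lie, lie_lie, map_sub, hy z, hx z, hx, hy] }
  have hT : ∀ v ∈ T, f v = 0 → ∀ y : S, ⁅v, y⁆ = 0 := fun v hv hfv y => by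
    rw [← h2 ⁅v, y⁆ (by rw [LieHom.map_lie, hfv, zero_lie]), ← hv y]
    exact hV v _ hfv (h1 y)
  obtain ⟨B, hB1, hB2, hB3⟩ := exists_complement_of_central_ker (f.comp T.incl)
    (fun q => by
      obtain ⟨x, rfl⟩ := hf q
      obtain ⟨v, hv, h⟩ := h3 x
      -- Adding `v ∈ V` changes the defect of `x` by `-ad v`, which cancels it.
      refine ⟨⟨x + v, fun y => ?_⟩, ?_⟩
      · rw [add_lie, add_lie, map_add, hV v _ hv (h1 y), add_zero,
          h2 ⁅v, y⁆ (by rw [LieHom.map_lie, hv, zero_lie]), ← h y]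
        abel
      · change f (x + v) = f x
        rw [map_add, hv, add_zero])
    (fun v w hv => Subtype.ext (hT v v.2 hv w))
    ({ toFun := fun a => ⟨α a, fun y => h4 a y⟩
       map_add' := fun a b => Subtype.ext (map_add α a b)
       map_smul' := fun t a => Subtype.ext (map_smul α t a)
       map_lie' := fun {a b} => Subtype.ext (LieHom.map_lie α a b) } : 𝔞 →ₗ⁅F⁆ T)
  refine ⟨B.map T.incl, fun a => ⟨_, hB1 a, rfl⟩, ?_, fun q => ?_⟩
  · rintro _ ⟨x, hx, rfl⟩ hfx
    exact congrArg Subtype.val (hB2 x hx hfx)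
  · obtain ⟨x, hx, rfl⟩ := hB3 q
    exact ⟨x, ⟨x, hx, rfl⟩, rfl⟩

end AbelianKernel

/-! ### Solvable ideals, quotients and the relative Levi theorem. -/

section Levi

variable {F : Type*} [Field F]

theorem LieIdeal.isSolvable_comap {S Q : Type*} [LieRing S] [LieAlgebra F S] [LieRing Q]
    [LieAlgebra F Q] (f : S →ₗ⁅F⁆ Q) [IsSolvable f.ker] (J : LieIdeal F Q) [IsSolvable J] :
    IsSolvable (J.comap f) := by
  obtain ⟨k, hk⟩ := IsSolvable.solvable F J
  obtain ⟨l, hl⟩ := IsSolvable.solvable F f.ker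
  rw [LieIdeal.derivedSeries_eq_bot_iff] at hk hl
  have h : ∀ k, derivedSeriesOfIdeal F S k (J.comap f) ≤
      (derivedSeriesOfIdeal F Q k J).comap f := by
    intro k
    induction k with
    | zero => exact le_rfl
    | succ k ih =>
      rw [derivedSeriesOfIdeal_succ, derivedSeriesOfIdeal_succ]
      exact (LieSubmodule.mono_lie ih ih).trans (LieIdeal.comap_bracket_le f)
  have hle : derivedSeriesOfIdeal F S k (J.comap f) ≤ f.ker := by
    refine (h k).trans ?_
    rw [hk]
    exact le_rfl
  refine IsSolvable.mk (R := F) (k := l + k) ((LieIdeal.derivedSeries_eq_bot_iff _ _).mpr ?_)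
  rw [derivedSeriesOfIdeal_add, eq_bot_iff, ← hl]
  exact derivedSeriesOfIdeal_mono hle l

theorem LieIdeal.isSolvable_comap_of_injective {S L : Type*} [LieRing S] [LieAlgebra F S]
    [LieRing L] [LieAlgebra F L] (f : S →ₗ⁅F⁆ L) (hf : Function.Injective f) (J : LieIdeal F L) [IsSolvable J] :
    IsSolvable (J.comap f) := by
  have : IsSolvable f.ker := by
    rw [(LieHom.ker_eq_bot f).mpr hf]; infer_instance
  exact LieIdeal.isSolvable_comap f J

theorem LieIdeal.isSolvable_map {S Q : Type*} [LieRing S] [LieAlgebra F S] [LieRing Q]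
    [LieAlgebra F Q] (f : S →ₗ⁅F⁆ Q) (hf : Function.Surjective f) (J : LieIdeal F S)
    [IsSolvable J] : IsSolvable (J.map f) := by
  obtain ⟨k, hk⟩ := IsSolvable.solvable F J
  rw [LieIdeal.derivedSeries_eq_bot_iff] at hk
  have h : ∀ k, derivedSeriesOfIdeal F Q k (J.map f) = (derivedSeriesOfIdeal F S k J).map f := by
    intro k
    induction k with
    | zero => rfl
    | succ k ih =>
      rw [derivedSeriesOfIdeal_succ, derivedSeriesOfIdeal_succ, ih, LieIdeal.map_bracket_eq _ hf]
  refine IsSolvable.mk (R := F) (k := k) ((LieIdeal.derivedSeries_eq_bot_iff _ _).mpr ?_)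
  rw [h, hk, LieIdeal.map_eq_bot_iff]
  exact bot_le

/-- The Lie algebra homomorphism induced on the quotient by an ideal. -/
def LieIdeal.quotientLift {S Q : Type*} [LieRing S] [LieAlgebra F S] [LieRing Q]
    [LieAlgebra F Q] (V : LieIdeal F S) (f : S →ₗ⁅F⁆ Q) (h : V ≤ f.ker) : S ⧸ V →ₗ⁅F⁆ Q :=
  { V.toSubmodule.liftQ (f : S →ₗ[F] Q) (fun _ hx => h hx) with
    map_lie' := by
      rintro ⟨x⟩ ⟨y⟩
      exact LieHom.map_lie f x y }

/-- The projection to the quotient by an ideal, as a homomorphism of Lie algebras. -/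
def LieIdeal.quotientMk {S : Type*} [LieRing S] [LieAlgebra F S] (V : LieIdeal F S) :
    S →ₗ⁅F⁆ S ⧸ V :=
  { (LieSubmodule.Quotient.mk' V : S →ₗ[F] S ⧸ V) with
    map_lie' := fun {x y} => LieSubmodule.Quotient.mk_bracket V x y }

theorem LieIdeal.quotientMk_surjective {S : Type*} [LieRing S] [LieAlgebra F S]
    (V : LieIdeal F S) : Function.Surjective V.quotientMk :=
  LieSubmodule.Quotient.surjective_mk' V

theorem LieIdeal.quotientMk_eq_zero {S : Type*} [LieRing S] [LieAlgebra F S]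
    (V : LieIdeal F S) {x : S} : V.quotientMk x = 0 ↔ x ∈ V :=
  LieSubmodule.Quotient.mk_eq_zero V

theorem LieIdeal.ker_quotientMk {S : Type*} [LieRing S] [LieAlgebra F S]
    (V : LieIdeal F S) : V.quotientMk.ker = V := by
  ext x
  rw [LieHom.mem_ker, LieIdeal.quotientMk_eq_zero]

theorem hasTrivialRadical_quotient_radical {S : Type*} [LieRing S] [LieAlgebra F S]
    [FiniteDimensional F S] : HasTrivialRadical F (S ⧸ radical F S) := by
  refine hasTrivialRadical_of_no_solvable_ideals fun J hJ => ?_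
  have hk : IsSolvable (radical F S).quotientMk.ker := by
    rw [LieIdeal.ker_quotientMk]; infer_instance
  have := LieIdeal.isSolvable_comap (radical F S).quotientMk J
  rw [LieIdeal.solvable_iff_le_radical] at this
  rw [eq_bot_iff]
  intro q hq
  obtain ⟨x, rfl⟩ := LieIdeal.quotientMk_surjective _ q
  exact (LieIdeal.quotientMk_eq_zero _).mpr (this (LieIdeal.mem_comap.mpr hq))

variable [CharZero F]

/-- **Levi's theorem**, relative to a semisimple Lie algebra `𝔞` mapping to `S`: a surjection
from `S` onto a semisimple Lie algebra with solvable kernel is split by a subalgebra containing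
the image of `𝔞`. -/
theorem exists_complement_of_solvable_ker {S : Type*} [LieRing S] [LieAlgebra F S]
    [FiniteDimensional F S]
    {Q : Type*} [LieRing Q] [LieAlgebra F Q] [FiniteDimensional F Q] [HasTrivialRadical F Q]
    {𝔞 : Type*} [LieRing 𝔞] [LieAlgebra F 𝔞] [FiniteDimensional F 𝔞] [HasTrivialRadical F 𝔞]
    (f : S →ₗ⁅F⁆ Q) (hf : Function.Surjective f) [IsSolvable f.ker] (α : 𝔞 →ₗ⁅F⁆ S) :
    ∃ B : LieSubalgebra F S, (∀ a, α a ∈ B) ∧ (∀ x ∈ B, f x = 0 → x = 0) ∧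
      ∀ q, ∃ x ∈ B, f x = q := by
  induction h : Module.finrank F S using Nat.strong_induction_on generalizing S with
  | _ n ih =>
  subst h
  by_cases hker : f.ker = ⊥
  · exact ⟨⊤, fun _ => trivial, fun x _ hx => (LieSubmodule.eq_bot_iff _).mp hker x hx,
      fun q => (hf q).imp fun x hx => ⟨trivial, hx⟩⟩
  -- The last nonzero term of the derived series of the kernel.
  set V : LieIdeal F S := derivedAbelianOfIdeal f.ker with hVdef
  have hVne : V ≠ ⊥ := fun h => hker ((abelian_of_solvable_ideal_eq_bot_iff f.ker).mp h)
  have hVab : IsLieAbelian V := abelian_derivedAbelianOfIdeal f.ker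
  have hVle : V ≤ f.ker := by
    rw [hVdef, derivedAbelianOfIdeal]
    split
    · exact bot_le
    · exact derivedSeriesOfIdeal_le_self _ _
  set π := V.quotientMk
  have hπ : Function.Surjective π := V.quotientMk_surjective
  let g : S ⧸ V →ₗ⁅F⁆ Q := V.quotientLift f hVle
  have hg : ∀ x, g (π x) = f x := fun x => rfl
  have hgs : Function.Surjective g := fun q => by
    obtain ⟨x, rfl⟩ := hf q
    exact ⟨π x, rfl⟩
  have hgk : IsSolvable g.ker := by
    have h1 : IsSolvable (f.ker.map π) := LieIdeal.isSolvable_map π hπ f.ker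
    refine le_solvable_ideal_solvable (fun y hy => ?_) h1
    obtain ⟨x, rfl⟩ := hπ y
    exact LieIdeal.mem_map (show x ∈ f.ker from hy)
  have hfd : FiniteDimensional F (S ⧸ V) := inferInstanceAs (FiniteDimensional F (S ⧸ V.toSubmodule))
  have hlt : Module.finrank F (S ⧸ V) < Module.finrank F S := by
    have hsum := Submodule.finrank_quotient_add_finrank V.toSubmodule
    have hpos : 0 < Module.finrank F V.toSubmodule :=
      Module.finrank_pos_iff.mpr (Submodule.nontrivial_iff_ne_bot.mpr (by simpa using hVne))
    change Module.finrank F (S ⧸ V.toSubmodule) < _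
    omega
  obtain ⟨C, hC1, hC2, hC3⟩ := ih _ hlt g hgs (π.comp α) rfl
  -- `T` maps onto `Q` with kernel inside the abelian `V`, and contains the image of `𝔞`.
  let T : LieSubalgebra F S := C.comap π
  have hTV : ∀ x ∈ T, f x = 0 → x ∈ V := fun x hx hfx =>
    V.quotientMk_eq_zero.mp (hC2 (π x) hx hfx)
  obtain ⟨B, hB1, hB2, hB3⟩ := exists_complement_of_abelian_ker (f.comp T.incl)
    (fun q => by
      obtain ⟨y, hy, rfl⟩ := hC3 q
      obtain ⟨x, rfl⟩ := hπ y
      exact ⟨⟨x, hy⟩, rfl⟩)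
    (fun v w hv hw => Subtype.ext (show ⁅(v : S), (w : S)⁆ = 0 from congrArg Subtype.val
      (hVab.trivial (⟨v, hTV v v.2 hv⟩ : V) (⟨w, hTV w w.2 hw⟩ : V))))
    ({ toFun := fun a => ⟨α a, hC1 a⟩
       map_add' := fun a b => Subtype.ext (map_add α a b)
       map_smul' := fun t a => Subtype.ext (map_smul α t a)
       map_lie' := fun {a b} => Subtype.ext (LieHom.map_lie α a b) } : 𝔞 →ₗ⁅F⁆ T)
  refine ⟨B.map T.incl, fun a => ⟨_, hB1 a, rfl⟩, ?_, fun q => ?_⟩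
  · rintro _ ⟨x, hx, rfl⟩ hfx
    exact congrArg Subtype.val (hB2 x hx hfx)
  · obtain ⟨x, hx, rfl⟩ := hB3 q
    exact ⟨x, ⟨x, hx, rfl⟩, rfl⟩

end Levi

/-! ### Radicals of ideals, and complements of the radical. -/

section Main

variable {F : Type*} [Field F] [CharZero F]
  {L : Type*} [LieRing L] [LieAlgebra F L] [FiniteDimensional F L]

/-- An ideal of an ideal of a semisimple Lie algebra is an ideal. -/
theorem HasTrivialRadical.lie_mem_of_le [HasTrivialRadical F L] (I : LieIdeal F L)
    (J : Submodule F L) (hJI : ∀ y ∈ J, y ∈ I) (hJ : ∀ x ∈ I, ∀ y ∈ J, ⁅x, y⁆ ∈ J)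
    (x : L) {y : L} (hy : y ∈ J) : ⁅x, y⁆ ∈ J := by
  obtain ⟨i, hi, j, hj, rfl⟩ := (LieSubmodule.mem_sup I Iᶜ x).mp
    ((sup_compl_eq_top (x := I)).symm ▸ LieSubmodule.mem_top x : x ∈ I ⊔ Iᶜ)
  have h0 : ⁅j, y⁆ = 0 := by
    have : ⁅j, y⁆ ∈ I ⊓ Iᶜ := ⟨lie_mem_right F L I j y (hJI y hy), lie_mem_left F L Iᶜ j y hj⟩
    rwa [inf_compl_eq_bot] at this
  rw [add_lie, h0, add_zero]
  exact hJ i hi y hy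

/-- The radical of an ideal, given as the range of an injective homomorphism, is the preimage of
the radical. -/
theorem radical_comap_of_isIdealMorphism {S : Type*} [LieRing S] [LieAlgebra F S]
    [FiniteDimensional F S] (ι : L →ₗ⁅F⁆ S) (hι : Function.Injective ι)
    (hid : ι.IsIdealMorphism) : (radical F S).comap ι = radical F L := by
  refine le_antisymm ?_ fun r hr => ?_
  · rw [← LieIdeal.solvable_iff_le_radical]
    exact LieIdeal.isSolvable_comap_of_injective ι hι _
  rw [LieHom.isIdealMorphism_iff] at hid
  set π := (radical F S).quotientMk
  have hπ : Function.Surjective π := (radical F S).quotientMk_surjective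
  have htr : HasTrivialRadical F (S ⧸ radical F S) := hasTrivialRadical_quotient_radical
  have hfd : FiniteDimensional F (S ⧸ radical F S) :=
    inferInstanceAs (FiniteDimensional F (S ⧸ (radical F S).toSubmodule))
  let g : L →ₗ⁅F⁆ S ⧸ radical F S := π.comp ι
  have hg : g.IsIdealMorphism := by
    rw [LieHom.isIdealMorphism_iff]
    intro q l
    obtain ⟨x, rfl⟩ := hπ q
    obtain ⟨z, hz⟩ := hid x l
    exact ⟨z, by change ⁅π x, π (ι l)⁆ = π (ι z); rw [← hz, LieHom.map_lie]⟩
  -- The image of `rad L` is an ideal of the image of `L`, itself an ideal of a semisimple algebra;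
  -- so `J` is a solvable ideal there and vanishes.
  let J : LieIdeal F (S ⧸ radical F S) :=
    { (radical F L).toSubmodule.map (g : L →ₗ[F] S ⧸ radical F S) with
      lie_mem := by
        intro x y hy
        refine HasTrivialRadical.lie_mem_of_le g.idealRange _ ?_ ?_ x hy
        · rintro _ ⟨r, _, rfl⟩
          exact g.mem_idealRange r
        · rintro _ hx _ ⟨r, hr, rfl⟩
          obtain ⟨l, rfl⟩ := (LieHom.mem_idealRange_iff g hg).mp hx
          exact ⟨⁅l, r⁆, lie_mem_right F L _ l r hr, LieHom.map_lie g l r⟩ }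
  let k : radical F L →ₗ⁅F⁆ J :=
    { toFun := fun r => ⟨g r, ⟨r, r.2, rfl⟩⟩
      map_add' := fun a b => Subtype.ext (map_add g (a : L) b)
      map_smul' := fun t a => Subtype.ext (map_smul g t (a : L))
      map_lie' := fun {a b} => Subtype.ext (LieHom.map_lie g (a : L) b) }
  have hk : Function.Surjective k := by
    rintro ⟨_, r, hr, rfl⟩
    exact ⟨⟨r, hr⟩, rfl⟩
  have hJ : IsSolvable J := hk.lieAlgebra_isSolvable
  have hJ0 : J = ⊥ := HasTrivialRadical.eq_bot_of_isSolvable J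
  exact (LieIdeal.quotientMk_eq_zero (radical F S)).mp ((LieSubmodule.eq_bot_iff J).mp hJ0 (g r) ⟨r, hr, rfl⟩)

/-- A subalgebra complementary to the radical is semisimple. -/
theorem isSemisimple_of_isCompl_radical (B : LieSubalgebra F L)
    (hB : IsCompl B.toSubmodule (radical F L).toSubmodule) : IsSemisimple F B := by
  have htr : HasTrivialRadical F (L ⧸ radical F L) := hasTrivialRadical_quotient_radical
  let h : B →ₗ⁅F⁆ L ⧸ radical F L := (radical F L).quotientMk.comp B.incl
  have hs : Function.Surjective h := fun q => by
    obtain ⟨x, rfl⟩ := (radical F L).quotientMk_surjective q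
    obtain ⟨b, hb, r, hr, rfl⟩ := Submodule.mem_sup.mp (hB.sup_eq_top ▸ Submodule.mem_top :
      x ∈ B.toSubmodule ⊔ (radical F L).toSubmodule)
    refine ⟨⟨b, hb⟩, ?_⟩
    rw [map_add, (LieIdeal.quotientMk_eq_zero _).mpr hr, add_zero]
    rfl
  have : HasTrivialRadical F B := hasTrivialRadical_of_no_solvable_ideals fun J hJ => by
    have h1 : IsSolvable (J.map h) := LieIdeal.isSolvable_map h hs J
    have h2 : J.map h = ⊥ := HasTrivialRadical.eq_bot_of_isSolvable _
    rw [LieSubmodule.eq_bot_iff]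
    intro b hb
    have h3 : h b = 0 := LieIdeal.map_eq_bot_iff.mp h2 hb
    exact Subtype.ext (Submodule.disjoint_def.mp hB.disjoint b b.2
      ((LieIdeal.quotientMk_eq_zero _).mp h3))
  infer_instance

/-- A subalgebra complementary to the radical is maximal among semisimple subalgebras. -/
theorem maximal_isSemisimple_of_isCompl_radical (B : LieSubalgebra F L)
    (hB : IsCompl B.toSubmodule (radical F L).toSubmodule) :
    Maximal (fun S : LieSubalgebra F L => IsSemisimple F S) B := by
  refine ⟨isSemisimple_of_isCompl_radical B hB, fun S hS hBS s hs => ?_⟩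
  obtain ⟨b, hb, r, hr, rfl⟩ := Submodule.mem_sup.mp (hB.sup_eq_top ▸ Submodule.mem_top :
    s ∈ B.toSubmodule ⊔ (radical F L).toSubmodule)
  have hrS : r ∈ S := by
    have := S.sub_mem hs (hBS hb)
    rwa [add_sub_cancel_left] at this
  -- The radical meets the semisimple `S` in a solvable ideal of `S`, hence in zero.
  have : IsSolvable ((radical F L).comap S.incl) :=
    LieIdeal.isSolvable_comap_of_injective S.incl Subtype.val_injective _
  have hS' : IsSemisimple F S := hS
  have h0 : (radical F L).comap S.incl = ⊥ := HasTrivialRadical.eq_bot_of_isSolvable _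
  have hr0 : (⟨r, hrS⟩ : S) = 0 :=
    (LieSubmodule.eq_bot_iff _).mp h0 _ (LieIdeal.mem_comap.mpr hr)
  have : r = 0 := congrArg Subtype.val hr0
  rw [this, add_zero]
  exact hb

end Main

/-! ### The semidirect product argument. -/

theorem mainTheorem6 {F : Type*} [Field F] [IsAlgClosed F] [CharZero F]
    {L : Type*} [LieRing L] [LieAlgebra F L] [FiniteDimensional F L]
    {𝔤 : Type*} [LieRing 𝔤] [LieAlgebra F 𝔤] [FiniteDimensional F 𝔤]
    [LieAlgebra.IsSemisimple F 𝔤]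
    (ρ : 𝔤 →ₗ⁅F⁆ LieDerivation F L L) :
    ∃ B : LieSubalgebra F L,
      Maximal (fun S : LieSubalgebra F L => LieAlgebra.IsSemisimple F S) B ∧
      (∀ x : 𝔤, ∀ b ∈ B, ρ x b ∈ B) ∧
      (∀ x : 𝔤, ∀ r ∈ LieAlgebra.radical F L, ρ x r ∈ LieAlgebra.radical F L) ∧
      IsCompl B.toSubmodule (LieAlgebra.radical F L).toSubmodule := by
  let S := L ⋊⁅ρ⁆ 𝔤
  let ι : L →ₗ⁅F⁆ S := SemiDirectSum.inl ρ
  let κ : 𝔤 →ₗ⁅F⁆ S := SemiDirectSum.inr ρ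
  have hι : Function.Injective ι := SemiDirectSum.inl_injective ρ
  have hfd : FiniteDimensional F S := Module.Finite.equiv (SemiDirectSum.toProdl ρ).symm
  have hκι : ∀ x l, ⁅κ x, ι l⁆ = ι (ρ x l) := fun x l => by
    change ⁅SemiDirectSum.inr ρ x, SemiDirectSum.inl ρ l⁆ = SemiDirectSum.inl ρ (ρ x l)
    simp
  have hrange : ∀ s : S, SemiDirectSum.projr ρ s = 0 → ∃ l, ι l = s := fun s hs =>
    ⟨s.left, SemiDirectSum.ext rfl hs.symm⟩
  have hid : ι.IsIdealMorphism := by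
    rw [LieHom.isIdealMorphism_iff]
    intro s l
    obtain ⟨z, hz⟩ := hrange ⁅s, ι l⁆ (by
      rw [LieHom.map_lie, SemiDirectSum.projr_inl_apply, lie_zero])
    exact ⟨z, hz.symm⟩
  have hrad : (radical F S).comap ι = radical F L := radical_comap_of_isIdealMorphism ι hι hid
  have hmem : ∀ l, l ∈ radical F L ↔ ι l ∈ radical F S := fun l => by
    rw [← hrad, LieIdeal.mem_comap]
  have hright : ∀ s ∈ radical F S, ∃ r ∈ radical F L, ι r = s := fun s hs => by
    have h1 : IsSolvable ((radical F S).map (SemiDirectSum.projr ρ)) :=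
      LieIdeal.isSolvable_map _ (SemiDirectSum.projr_surjective ρ) _
    obtain ⟨r, rfl⟩ := hrange s
      (LieIdeal.map_eq_bot_iff.mp (HasTrivialRadical.eq_bot_of_isSolvable _) hs)
    exact ⟨r, (hmem r).mpr hs, rfl⟩
  set π := (radical F S).quotientMk
  have hπ0 : ∀ {s : S}, π s = 0 ↔ s ∈ radical F S := (radical F S).quotientMk_eq_zero
  have htr : HasTrivialRadical F (S ⧸ radical F S) := hasTrivialRadical_quotient_radical
  have hfd' : FiniteDimensional F (S ⧸ radical F S) :=
    inferInstanceAs (FiniteDimensional F (S ⧸ (radical F S).toSubmodule))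
  have hks : IsSolvable π.ker := by
    rw [LieIdeal.ker_quotientMk]; infer_instance
  obtain ⟨C, hC1, hC2, hC3⟩ := exists_complement_of_solvable_ker π
    (radical F S).quotientMk_surjective κ
  have hcompl : IsCompl (C.comap ι).toSubmodule (radical F L).toSubmodule := by
    constructor
    · rw [Submodule.disjoint_def]
      intro b hb hr
      have : ι b = 0 := hC2 (ι b) hb (hπ0.mpr ((hmem b).mp hr))
      exact hι (this.trans (map_zero ι).symm)
    · rw [codisjoint_iff, eq_top_iff]
      intro l _
      obtain ⟨s, hs, hsl⟩ := hC3 (π (ι l))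
      -- The `rad S`-component of an element of `L` lies in `L`, hence so does its `C`-component.
      obtain ⟨r, hr, hrs⟩ := hright (ι l - s) (hπ0.mp (by rw [map_sub, hsl, sub_self]))
      refine Submodule.mem_sup.mpr ⟨l - r, ?_, r, hr, sub_add_cancel l r⟩
      change ι (l - r) ∈ C
      rwa [map_sub, hrs, sub_sub_cancel]
  refine ⟨C.comap ι, maximal_isSemisimple_of_isCompl_radical _ hcompl, fun x b hb => ?_,
    fun x r hr => ?_, hcompl⟩
  · change ι (ρ x b) ∈ C
    rw [← hκι]
    exact C.lie_mem (hC1 x) hb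
  · rw [hmem, ← hκι]
    exact lie_mem_right F S _ _ _ ((hmem r).mp hr)
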